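/- Let $a\ge 1$ and $t_1,\dots,t_a\in\mathbb N$ be fixed, and put $T_0=\sum_i t_i$. Consider a sequence of designs. In each design let $\boldsymbol Y_{ik}$ ($1\le i\le a$, $1\le k\le n_i$) be independent random vectors in $\mathbb R^{t_i}$ which, for fixed $i$, are identically distributed with expectation $\boldsymbol\mu_i$ and covariance matrix $\boldsymbol V_i$. Let $N=\sum_i n_i$, and suppose that $\min_i n_i\to\infty$ and $n_i/N\to\kappa_i>0$ for every $i$. The distributions of the $\boldsymbol Y_{ik}$, and hence the $\boldsymbol\mu_i$, may vary along the sequence; the $\boldsymbol V_i$ do not, and $E\|\boldsymbol Y_{i1}-\boldsymbol\mu_i\|^4<\infty$ is bounded over $i$ and along the sequence. Let $\boldsymbol\mu=(\boldsymbol\mu_1',\dots,\boldsymbol\mu_a')'\in\mathbb R^{T_0}$, let $\overline{\boldsymbol Y}_\cdot$ be the stacked vector of the group means $n_i^{-1}\sum_{k}\boldsymbol Y_{ik}$, and let $\boldsymbol\Sigma=\bigoplus_{i=1}^a\kappa_i^{-1}\boldsymbol V_i$. Let $\boldsymbol H$ be a real matrix with $T_0$ columns (for instance a contrast matrix), let $(\boldsymbol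 H\boldsymbol H')^-$ be any generalized inverse of $\boldsymbol H\boldsymbol H'$, and put $\boldsymbol T=\boldsymbol H'(\boldsymbol H\boldsymbol H')^-\boldsymbol H$ and $\widetilde Q_N=N\,\overline{\boldsymbol Y}_\cdot'\boldsymbol T\,\overline{\boldsymbol Y}_\cdot$ (the ANOVA-type statistic). Then the eigenvalues $\lambda_{is}$ ($1\le i\le a$, $1\le s\le t_i$) of $\boldsymbol T\boldsymbol\Sigma$, listed with multiplicity, are real, and the following holds. 1. If $\boldsymbol H\boldsymbol\mu=\boldsymbol 0$ along the sequence, then $\widetilde Q_N$ converges in distribution to $\sum_{i=1}^a\sum_{s=1}^{t_i}\lambda_{is}X_{is}$, where the $X_{is}$ are independent and $\chi^2_1$-distributed. 2. Let $\boldsymbol\nu\in\mathbb R^{T_0}$. If $\boldsymbol T\boldsymbol\mu=\boldsymbol T\boldsymbol\nu/\sqrt N$ along the sequence, then $\widetilde Q_N$ converges in distribution to $\boldsymbol Z'\boldsymbol T\boldsymbol Z$, where $\boldsymbol Z\sim N(\boldsymbol\nu,\boldsymbol\Sigma)$. 3. If in addition $\boldsymbol\Sigma>0$, there are vectors $\boldsymbol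 w_{is}\in\mathbb R^{T_0}$ with $\boldsymbol T\boldsymbol\Sigma\boldsymbol w_{is}=\lambda_{is}\boldsymbol w_{is}$, $\boldsymbol w_{is}'\boldsymbol\Sigma\boldsymbol w_{is}=1$ and $\boldsymbol w_{is}'\boldsymbol\Sigma\boldsymbol w_{jr}=0$ for $(i,s)\ne(j,r)$, such that $\boldsymbol Z'\boldsymbol T\boldsymbol Z$ has the same distribution as $\sum_{i,s}\lambda_{is}X_{is}$, and hence $\widetilde Q_N$ converges in distribution to this sum, where the $X_{is}$ are independent and noncentrally $\chi^2_1(\delta_{is})$-distributed with noncentrality parameters $\delta_{is}=(\boldsymbol w_{is}'\boldsymbol\nu)^2$. The total noncentrality is $\sum_{i,s}\delta_{is}=\boldsymbol\nu'\boldsymbol\Sigma^{-1}\boldsymbol\nu$. -/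

import Mathlib

open MeasureTheory ProbabilityTheory Filter Topology Matrix

/-- `G` is a generalized inverse (g-inverse) of `A`: `A G A = A`. -/
def IsGInverse {m n : Type*} [Fintype m] [Fintype n]
    (A : Matrix m n ℝ) (G : Matrix n m ℝ) : Prop :=
  A * G * A = A

/-- The noncentral chi-square law with one degree of freedom and noncentrality `δ ≥ 0`:
the law of `W ^ 2` for `W ∼ N(√δ, 1)`. -/
noncomputable def noncentralChiSqOne (δ : ℝ) : Measure ℝ :=
  (gaussianReal (√δ) 1).map (fun x => x ^ 2)

/-- The (central) chi-square law with one degree of freedom: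
the law of `W ^ 2` for `W ∼ N(0, 1)`. -/
noncomputable def chiSqOne : Measure ℝ :=
  (gaussianReal 0 1).map (fun x => x ^ 2)

instance isProbabilityMeasure_noncentralChiSqOne (δ : ℝ) :
    IsProbabilityMeasure (noncentralChiSqOne δ) :=
  Measure.isProbabilityMeasure_map (by fun_prop)

instance isProbabilityMeasure_chiSqOne : IsProbabilityMeasure chiSqOne :=
  Measure.isProbabilityMeasure_map (by fun_prop)

/-- `lam` lists the eigenvalues of the square matrix `A`, repeated according to their
(algebraic) multiplicities: `det (X - A) = ∏ j, (X - lam j)`. -/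
def ListsEigenvalues {ι : Type*} [Fintype ι] [DecidableEq ι]
    (A : Matrix ι ι ℝ) (lam : ι → ℝ) : Prop :=
  A.charpoly = ∏ j, (Polynomial.X - Polynomial.C (lam j))

/-- Concatenation `(x₁', …, x_a')'` of vectors `x_i ∈ ℝ^{t_i}`. -/
def stack {a : ℕ} {t : Fin a → ℕ} (x : ∀ i, EuclideanSpace ℝ (Fin (t i))) :
    (Σ i, Fin (t i)) → ℝ :=
  fun p => x p.1 p.2

/-- The total number of subjects. -/
def totalSize {a : ℕ} (n : Fin a → ℕ) : ℕ := ∑ i, n i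

/-- The vector of all group-wise sample means `n_i⁻¹ ∑_k Y_{iks}`, stacked over the groups. -/
noncomputable def sampleMean {a : ℕ} {t : Fin a → ℕ} {n : Fin a → ℕ}
    (y : ∀ i, Fin (n i) → EuclideanSpace ℝ (Fin (t i))) : (Σ i, Fin (t i)) → ℝ :=
  stack fun i => (n i : ℝ)⁻¹ • ∑ k, y i k

/-- The matrix `T = H' G H`, where `G` is to be a generalized inverse of `H H'`. -/
def projMatrix {m : ℕ} {ι : Type*} [Fintype ι]
    (H : Matrix (Fin m) ι ℝ) (G : Matrix (Fin m) (Fin m) ℝ) : Matrix ι ι ℝ :=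
  Hᵀ * G * H

/-- The ANOVA-type statistic `N Ȳ' H' G H Ȳ` of the data `y`. -/
noncomputable def anovaTypeStat {a m : ℕ} {t : Fin a → ℕ} {n : Fin a → ℕ}
    (H : Matrix (Fin m) (Σ i, Fin (t i)) ℝ) (G : Matrix (Fin m) (Fin m) ℝ)
    (y : ∀ i, Fin (n i) → EuclideanSpace ℝ (Fin (t i))) : ℝ :=
  (totalSize n : ℝ) * (sampleMean y ⬝ᵥ (projMatrix H G *ᵥ sampleMean y))

/-- The asymptotic covariance matrix: the direct sum of the blocks `κ_i⁻¹ V_i`. -/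
noncomputable def asympCov {a : ℕ} {t : Fin a → ℕ} (κ : Fin a → ℝ)
    (V : ∀ i, Matrix (Fin (t i)) (Fin (t i)) ℝ) :
    Matrix (Σ i, Fin (t i)) (Σ i, Fin (t i)) ℝ :=
  Matrix.blockDiagonal' fun i => (κ i)⁻¹ • V i

/-- A sequence (index `r`) of heteroscedastic repeated measures designs with `a` groups.
At stage `r` group `i` consists of `n r i` random vectors with values in `ℝ^{t_i}`; all vectors of
a stage are independent, those of group `i` have the law `F r i`, with mean `μ r i` and covariance
matrix `V i`. The laws may change with the stage (as they must under local alternatives, where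
the means do), the covariance matrices do not, and the fourth moments are bounded over groups and
stages. The group sizes tend to infinity with `n_i / N → κ_i > 0`. -/
structure IsRepeatedMeasuresDesign {a : ℕ} {t : Fin a → ℕ} {n : ℕ → Fin a → ℕ}
    {Ω : ℕ → Type*} [∀ r, MeasurableSpace (Ω r)] (P : ∀ r, Measure (Ω r))
    (Y : ∀ r i, Fin (n r i) → Ω r → EuclideanSpace ℝ (Fin (t i)))
    (F : ℕ → ∀ i, Measure (EuclideanSpace ℝ (Fin (t i))))
    (μ : ℕ → ∀ i, EuclideanSpace ℝ (Fin (t i)))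
    (V : ∀ i, Matrix (Fin (t i)) (Fin (t i)) ℝ) (κ : Fin a → ℝ) : Prop where
  size_pos : ∀ r i, 0 < n r i
  size_tendsto : ∀ i, Tendsto (fun r => n r i) atTop atTop
  ratio_pos : ∀ i, 0 < κ i
  ratio_tendsto : ∀ i,
    Tendsto (fun r => (n r i : ℝ) / (totalSize (n r) : ℝ)) atTop (𝓝 (κ i))
  indep : ∀ r, iIndepFun (fun (p : Σ i, Fin (n r i)) => Y r p.1 p.2) (P r)
  hasLaw : ∀ r i k, HasLaw (Y r i k) (F r i) (P r)
  mean_eq : ∀ r i, ∫ x, x ∂(F r i) = μ r i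
  cov_eq : ∀ r i s s', cov[fun x => x s, fun x => x s'; F r i] = V i s s'
  memLp_four : ∀ r i, MemLp (fun x => x) 4 (F r i)
  fourth_moment_bdd : ∃ C : ℝ, ∀ r i, ∫ x, ‖x - μ r i‖ ^ 4 ∂(F r i) ≤ C

/-! Whatever g-inverse is chosen, `T` is symmetric and idempotent, so the statistic is `‖√N T Ȳ‖²`.
If `√N T μ = T ν`, it therefore equals `q(ν + √N(Ȳ - μ))` exactly, with `q z = z' T z`; the null
hypothesis is the case `ν = 0`. Hence it suffices to prove `√N(Ȳ - μ) → N(0, Σ)` in distribution and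
to apply continuous mapping.

The laws vary along the sequence, so the central limit theorem is one for triangular arrays.
Independence factors the characteristic function, and a Taylor estimate, uniform by the fourth
moment bound, gives the limit of each factor (`tendsto_integral_cexp_inner_pow`).

For the limit law, put `R = √Σ` and suppose `ν = R c`. With `x` standard normal, `Z = R(x + c)` and
`Z' T Z = (x + c)' R T R (x + c)`. The symmetric matrix `R T R` has the characteristic polynomial of
`T Σ`; in an orthonormal eigenbasis `b j` the form becomes `∑ lam j (b j ⬝ x + b j ⬝ c)²`, with
independent standard normal `b j ⬝ x`. For `ν = 0` take `c = 0`, even if `Σ` is singular; for `Σ >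
0` take `c = R⁻¹ ν` and `w j = R⁻¹ b j`. -/

/-! ### Listings of eigenvalues -/

theorem exists_perm_comp_eq_of_map_univ_eq {ι α : Type*} [Fintype ι] {f g : ι → α}
    (h : Finset.univ.val.map f = Finset.univ.val.map g) : ∃ σ : Equiv.Perm ι, g ∘ σ = f := by
  classical
  -- Equal multiplicities make the fibres over each value equinumerous; bijections of fibres glue to
  -- a permutation.
  have hcard (c : α) : Nonempty ({x // f x = c} ≃ {x // g x = c}) := by
    refine ⟨Fintype.equivOfCardEq ?_⟩
    have := congrArg (Multiset.count c) h
    rw [Multiset.count_map, Multiset.count_map] at this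
    rw [Fintype.card_subtype, Fintype.card_subtype]
    simpa [Finset.card, eq_comm] using this
  let e c := (hcard c).some
  refine ⟨(Equiv.sigmaFiberEquiv f).symm.trans
    ((Equiv.sigmaCongrRight e).trans (Equiv.sigmaFiberEquiv g)), ?_⟩
  ext x
  exact (e (f x) ⟨x, rfl⟩).2

/-- Both families enumerate the roots of the characteristic polynomial. This transfers the spectral
theorem from its own listing to an arbitrary one. -/
theorem ListsEigenvalues.exists_perm {ι : Type*} [Fintype ι] [DecidableEq ι]
    {A : Matrix ι ι ℝ} {lam lam' : ι → ℝ} (h : ListsEigenvalues A lam)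
    (h' : ListsEigenvalues A lam') : ∃ σ : Equiv.Perm ι, lam' ∘ σ = lam := by
  apply exists_perm_comp_eq_of_map_univ_eq
  have key (l : ι → ℝ) (hl : ListsEigenvalues A l) :
      A.charpoly.roots = Finset.univ.val.map l := by
    have := Polynomial.roots_multiset_prod_X_sub_C (Finset.univ.val.map l)
    rwa [Multiset.map_map, show ((Finset.univ.val.map
      ((fun a => Polynomial.X - Polynomial.C a) ∘ l)).prod) = A.charpoly from hl.symm] at this
  rw [← key lam h, key lam' h']

theorem Matrix.IsHermitian.listsEigenvalues {ι : Type*} [Fintype ι] [DecidableEq ι]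
    {A : Matrix ι ι ℝ} (hA : A.IsHermitian) : ListsEigenvalues A hA.eigenvalues := by
  simpa [ListsEigenvalues] using hA.charpoly_eq

/-- A symmetric real matrix has an orthonormal eigenbasis matching any listing of its
eigenvalues. -/
theorem Matrix.IsHermitian.exists_orthonormalBasis {ι : Type*} [Fintype ι] [DecidableEq ι]
    {A : Matrix ι ι ℝ} (hA : A.IsHermitian) {lam : ι → ℝ} (h : ListsEigenvalues A lam) :
    ∃ b : OrthonormalBasis ι ℝ (EuclideanSpace ℝ ι),
      ∀ j, A *ᵥ (b j).ofLp = lam j • (b j).ofLp := by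
  obtain ⟨σ, hσ⟩ := h.exists_perm hA.listsEigenvalues
  refine ⟨hA.eigenvectorBasis.reindex σ.symm, fun j => ?_⟩
  rw [OrthonormalBasis.reindex_apply, ← hσ]
  simpa using hA.mulVec_eigenvectorBasis (σ j)

/-! ### The projection `T = H' G H` -/

section Projection

variable {m : ℕ} {ι : Type*} [Fintype ι] {H : Matrix (Fin m) ι ℝ} {G : Matrix (Fin m) (Fin m) ℝ}

/-- For `M = H H' G H - H = (H H' G - 1) H`, the g-inverse identity says `M H' = 0`. Hence `M M' =
0`, which forces `M = 0` over the reals. -/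
theorem IsGInverse.mul_mul_self (hG : IsGInverse (H * Hᵀ) G) : H * Hᵀ * G * H = H := by
  have h0 : (H * Hᵀ * G * H - H) * (H * Hᵀ * G * H - H)ᴴ = 0 := by
    rw [conjTranspose_eq_transpose_of_trivial]
    have h1 : (H * Hᵀ * G * H - H) * Hᵀ = 0 := by
      rw [Matrix.sub_mul, sub_eq_zero, Matrix.mul_assoc (H * Hᵀ * G)]
      exact hG
    have h2 : H * Hᵀ * G * H - H = (H * Hᵀ * G - 1) * H := by
      rw [Matrix.sub_mul, Matrix.one_mul]
    rw [h2, transpose_mul, ← Matrix.mul_assoc, ← h2, h1, Matrix.zero_mul]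
  exact sub_eq_zero.1 (self_mul_conjTranspose_eq_zero.1 h0)

/-- The left side is symmetric, so this one identity yields both symmetry and idempotence of `T`,
although `G` itself need not be symmetric. -/
theorem IsGInverse.transpose_projMatrix_mul (hG : IsGInverse (H * Hᵀ) G) :
    (projMatrix H G)ᵀ * projMatrix H G = (projMatrix H G)ᵀ := by
  have : (projMatrix H G)ᵀ * projMatrix H G = Hᵀ * Gᵀ * (H * Hᵀ * G * H) := by
    simp [projMatrix, transpose_mul, Matrix.mul_assoc]
  rw [this, hG.mul_mul_self]
  simp [projMatrix, transpose_mul, Matrix.mul_assoc]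

theorem IsGInverse.isSymm_projMatrix (hG : IsGInverse (H * Hᵀ) G) : (projMatrix H G).IsSymm := by
  have h := hG.transpose_projMatrix_mul
  have h' := congrArg transpose h
  rw [transpose_mul, transpose_transpose, h] at h'
  exact h'

theorem IsGInverse.projMatrix_mul_self (hG : IsGInverse (H * Hᵀ) G) :
    projMatrix H G * projMatrix H G = projMatrix H G := by
  have h := hG.transpose_projMatrix_mul
  rwa [hG.isSymm_projMatrix] at h

theorem IsGInverse.dotProduct_projMatrix (hG : IsGInverse (H * Hᵀ) G) (x : ι → ℝ) :
    x ⬝ᵥ (projMatrix H G *ᵥ x) = (projMatrix H G *ᵥ x) ⬝ᵥ (projMatrix H G *ᵥ x) := by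
  conv_rhs => rw [dotProduct_mulVec, vecMul_mulVec, ← dotProduct_mulVec, hG.transpose_projMatrix_mul,
    hG.isSymm_projMatrix]

end Projection

/-! ### Quadratic forms in Gaussian vectors -/

section Gaussian

open scoped MatrixOrder

variable {ι : Type*} [Fintype ι]

theorem noncentralChiSqOne_zero : noncentralChiSqOne 0 = chiSqOne := by
  simp [noncentralChiSqOne, chiSqOne]

theorem map_add_sq_gaussianReal (c : ℝ) :
    (gaussianReal 0 1).map (fun x => (x + c) ^ 2) = noncentralChiSqOne (c ^ 2) := by
  have h : (gaussianReal 0 1).map (fun x => (x + c) ^ 2) =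
      (gaussianReal c 1).map (fun x => x ^ 2) := by
    have := gaussianReal_map_add_const (μ := 0) (v := 1) c
    rw [zero_add] at this
    rw [← this, Measure.map_map (by fun_prop) (by fun_prop)]
    rfl
  rw [h, noncentralChiSqOne, Real.sqrt_sq_eq_abs]
  -- The definition uses the mean `√(c²) = |c|`; a negative `c` is reflected, which squaring does
  -- not see.
  rcases abs_choice c with hc | hc
  · rw [hc]
  · rw [hc, ← gaussianReal_map_neg, Measure.map_map (by fun_prop) (by fun_prop)]
    congr 1
    ext x
    simp

/-- Coordinates in an orthonormal basis are a linear isometry, under which the standard Gaussian law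
is invariant. -/
theorem map_inner_stdGaussian (b : OrthonormalBasis ι ℝ (EuclideanSpace ℝ ι)) :
    (stdGaussian (EuclideanSpace ℝ ι)).map (fun x j => (b j).ofLp ⬝ᵥ x.ofLp) =
      Measure.pi fun _ => gaussianReal 0 1 := by
  have h : (fun (x : EuclideanSpace ℝ ι) j => (b j).ofLp ⬝ᵥ x.ofLp) =
      (WithLp.ofLp : EuclideanSpace ℝ ι → ι → ℝ) ∘ b.repr := by
    ext x j
    simp [b.repr_apply_apply, PiLp.inner_apply, dotProduct, mul_comm]
  rw [h, ← Measure.map_map (by fun_prop) (by fun_prop), stdGaussian_map, ← map_pi_eq_stdGaussian,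
    Measure.map_map (by fun_prop) (by fun_prop)]
  exact Measure.map_id

theorem dotProduct_mulVec_eq_sum_eigenbasis {A : Matrix ι ι ℝ} {lam : ι → ℝ}
    (b : OrthonormalBasis ι ℝ (EuclideanSpace ℝ ι))
    (hb : ∀ j, A *ᵥ (b j).ofLp = lam j • (b j).ofLp) (x : EuclideanSpace ℝ ι) :
    x.ofLp ⬝ᵥ (A *ᵥ x.ofLp) = ∑ j, lam j * ((b j).ofLp ⬝ᵥ x.ofLp) ^ 2 := by
  have hx : x.ofLp = ∑ j, ((b j).ofLp ⬝ᵥ x.ofLp) • (b j).ofLp := by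
    conv_lhs => rw [← b.sum_repr x]
    simp [b.repr_apply_apply, PiLp.inner_apply, dotProduct, mul_comm]
  have hA : A *ᵥ x.ofLp = ∑ j, ((b j).ofLp ⬝ᵥ x.ofLp) • lam j • (b j).ofLp := by
    conv_lhs => rw [hx, mulVec_sum]
    simp_rw [mulVec_smul, hb]
  rw [hA, dotProduct_sum]
  refine Finset.sum_congr rfl fun j _ => ?_
  rw [dotProduct_smul, dotProduct_smul, dotProduct_comm x.ofLp]
  simp only [smul_eq_mul]
  ring

variable [DecidableEq ι]

theorem Matrix.PosSemidef.sqrt_mul_sqrt {S : Matrix ι ι ℝ} (hS : S.PosSemidef) :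
    CFC.sqrt S * CFC.sqrt S = S := by
  exact CFC.sqrt_mul_sqrt_self _ hS.nonneg

theorem Matrix.isSymm_sqrt (S : Matrix ι ι ℝ) : (CFC.sqrt S).IsSymm := by
  have := (CFC.sqrt_nonneg S).isSelfAdjoint
  simpa [IsSelfAdjoint, star_eq_conjTranspose, Matrix.IsSymm] using this

/-- `A B` and `B A` have the same characteristic polynomial. Thus `T S`, in general not symmetric,
inherits real eigenvalues from a symmetric matrix. -/
theorem Matrix.PosSemidef.listsEigenvalues_sqrt_conj {S T : Matrix ι ι ℝ} (hS : S.PosSemidef)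
    {lam : ι → ℝ} : ListsEigenvalues (CFC.sqrt S * T * CFC.sqrt S) lam ↔
      ListsEigenvalues (T * S) lam := by
  rw [ListsEigenvalues, ListsEigenvalues, Matrix.mul_assoc, Matrix.charpoly_mul_comm,
    Matrix.mul_assoc, hS.sqrt_mul_sqrt]

theorem Matrix.IsSymm.isHermitian_sqrt_conj {T : Matrix ι ι ℝ} (hT : T.IsSymm)
    (S : Matrix ι ι ℝ) : (CFC.sqrt S * T * CFC.sqrt S).IsHermitian := by
  rw [Matrix.IsHermitian, conjTranspose_eq_transpose_of_trivial]
  simp [transpose_mul, (isSymm_sqrt S).eq, hT.eq, Matrix.mul_assoc]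

/-- A quadratic form in a Gaussian vector whose mean lies in the range of `√S` is a weighted sum
of independent noncentral chi-square variables. -/
theorem identDistrib_quadForm_multivariateGaussian {S T : Matrix ι ι ℝ} {lam : ι → ℝ}
    (b : OrthonormalBasis ι ℝ (EuclideanSpace ℝ ι))
    (hb : ∀ j, (CFC.sqrt S * T * CFC.sqrt S) *ᵥ (b j).ofLp = lam j • (b j).ofLp)
    (c ν : EuclideanSpace ℝ ι) (hν : ν.ofLp = CFC.sqrt S *ᵥ c.ofLp) :
    IdentDistrib (fun z : EuclideanSpace ℝ ι => z.ofLp ⬝ᵥ (T *ᵥ z.ofLp))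
      (fun x : ι → ℝ => ∑ j, lam j * x j) (multivariateGaussian ν S)
      (Measure.pi fun j => noncentralChiSqOne (((b j).ofLp ⬝ᵥ c.ofLp) ^ 2)) where
  aemeasurable_fst := by
    have : Continuous (fun z : EuclideanSpace ℝ ι => z.ofLp ⬝ᵥ (T *ᵥ z.ofLp)) := by fun_prop
    exact this.measurable.aemeasurable
  aemeasurable_snd := (Finset.measurable_sum _ fun j _ => by fun_prop).aemeasurable
  map_eq := by
    have hq : Continuous (fun z : EuclideanSpace ℝ ι => z.ofLp ⬝ᵥ (T *ᵥ z.ofLp)) := by fun_prop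
    -- Both laws become images of the same standard Gaussian, which leaves a pointwise identity.
    have hpi : Measure.pi (fun j => noncentralChiSqOne (((b j).ofLp ⬝ᵥ c.ofLp) ^ 2)) =
        (stdGaussian (EuclideanSpace ℝ ι)).map
          (fun x j => ((b j).ofLp ⬝ᵥ x.ofLp + (b j).ofLp ⬝ᵥ c.ofLp) ^ 2) := by
      have h1 : (fun (x : EuclideanSpace ℝ ι) j =>
          ((b j).ofLp ⬝ᵥ x.ofLp + (b j).ofLp ⬝ᵥ c.ofLp) ^ 2) =
          (fun (y : ι → ℝ) j => (y j + (b j).ofLp ⬝ᵥ c.ofLp) ^ 2) ∘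
            (fun (x : EuclideanSpace ℝ ι) j => (b j).ofLp ⬝ᵥ x.ofLp) := rfl
      rw [h1, ← Measure.map_map (by fun_prop) (by unfold dotProduct; fun_prop), map_inner_stdGaussian]
      have hm (j : ι) : AEMeasurable (fun x : ℝ => (x + (b j).ofLp ⬝ᵥ c.ofLp) ^ 2)
        (gaussianReal 0 1) := by fun_prop
      have : ∀ j, SigmaFinite ((gaussianReal 0 1).map
          (fun x : ℝ => (x + (b j).ofLp ⬝ᵥ c.ofLp) ^ 2)) := fun j => by
        rw [map_add_sq_gaussianReal]; infer_instance
      rw [Measure.pi_map_pi hm]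
      simp_rw [map_add_sq_gaussianReal]
    rw [hpi, multivariateGaussian, Measure.map_map hq.measurable (by fun_prop),
      Measure.map_map (by fun_prop) (by unfold dotProduct; fun_prop)]
    congr 1
    ext x
    have hx : (ν + toEuclideanCLM (𝕜 := ℝ) (CFC.sqrt S) x).ofLp =
        CFC.sqrt S *ᵥ (x + c).ofLp := by
      rw [WithLp.ofLp_add, WithLp.ofLp_add, ofLp_toEuclideanCLM, hν, mulVec_add, add_comm]
    have := dotProduct_mulVec_eq_sum_eigenbasis b hb (x + c)
    simp only [Function.comp_apply]
    rw [hx]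
    simp only [← dotProduct_add, ← WithLp.ofLp_add]
    rw [← this, ← mulVec_mulVec, ← mulVec_mulVec, dotProduct_mulVec _ (CFC.sqrt S),
      ← mulVec_transpose, (isSymm_sqrt S).eq]

end Gaussian

/-! ### Characteristic function estimates -/

/-- For `|x| ≤ 1` this is the remainder of the exponential series. For `|x| > 1` every term is
compared with `|x|³`, at total cost `1 + 1 + 1 + 1/2 ≤ 4`. -/
theorem norm_cexp_mul_I_sub_taylor_le (x : ℝ) :
    ‖Complex.exp (x * Complex.I) - (1 + x * Complex.I - x ^ 2 / 2)‖ ≤ 4 * |x| ^ 3 := by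
  rcases le_or_gt |x| 1 with hx | hx
  · have h := Complex.exp_bound (x := x * Complex.I) (by simpa using hx) (n := 3) (by norm_num)
    have hs : ∑ m ∈ Finset.range 3, (x * Complex.I) ^ m / (m.factorial : ℂ) =
        1 + x * Complex.I - x ^ 2 / 2 := by
      simp [Finset.sum_range_succ, mul_pow, Nat.factorial]
      ring
    rw [hs] at h
    refine h.trans ?_
    have h3 : (0 : ℝ) ≤ |x| ^ 3 := by positivity
    norm_num [Nat.factorial]
    linarith
  · have h1 : ‖(1 : ℂ) + x * Complex.I - x ^ 2 / 2‖ ≤ 1 + |x| + |x| ^ 2 / 2 := by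
      refine (norm_sub_le _ _).trans (add_le_add ((norm_add_le _ _).trans ?_) ?_)
      · simp
      · simp
    refine (norm_sub_le _ _).trans ?_
    rw [Complex.norm_exp_ofReal_mul_I]
    have h2 : |x| ≤ |x| ^ 3 := by nlinarith [mul_pos (sub_pos.2 hx) (by linarith : 0 < |x|)]
    have h3 : |x| ^ 2 ≤ |x| ^ 3 := pow_le_pow_right₀ hx.le (by norm_num)
    linarith

/-- Since `log (1 + g) = g + O(g²)` and `m g² = (m g) g → 0`, the logarithm of the power has the
limit of `m g`. -/
theorem tendsto_one_add_pow_exp_of_tendsto_mul {l : Filter ℕ} {m : ℕ → ℕ} {g : ℕ → ℂ} {t : ℂ}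
    (hm : Tendsto m l atTop) (hg : Tendsto (fun r => (m r : ℂ) * g r) l (𝓝 t)) :
    Tendsto (fun r => (1 + g r) ^ m r) l (𝓝 (Complex.exp t)) := by
  have hm' : Tendsto (fun r => (m r : ℂ)⁻¹) l (𝓝 0) := by
    have := (tendsto_inv_atTop_zero (𝕜 := ℝ)).comp ((tendsto_natCast_atTop_atTop (R := ℝ)).comp hm)
    simpa [Function.comp_def] using this.ofReal
  have hg0 : Tendsto g l (𝓝 0) := by
    have := hg.mul hm'
    rw [mul_zero] at this
    refine this.congr' ?_
    filter_upwards [hm.eventually_ne_atTop 0] with r hr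
    have : (m r : ℂ) ≠ 0 := by exact_mod_cast hr
    field_simp
  have hlog : Tendsto (fun r => (m r : ℂ) * Complex.log (1 + g r)) l (𝓝 t) := by
    have h1 : (fun r => (m r : ℂ) * (Complex.log (1 + g r) - g r)) =O[l]
        fun r => (m r : ℂ) * g r ^ 2 :=
      (Asymptotics.isBigO_refl _ _).mul (Complex.log_sub_self_isBigO.comp_tendsto hg0)
    have h2 : Tendsto (fun r => (m r : ℂ) * g r ^ 2) l (𝓝 0) := by
      have := hg.mul hg0
      rw [mul_zero] at this
      exact this.congr fun r => by ring
    have h3 := (h1.trans_tendsto h2).add hg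
    rw [zero_add] at h3
    exact h3.congr fun r => by ring
  refine ((Complex.continuous_exp.tendsto _).comp hlog).congr' ?_
  filter_upwards [hg0.eventually_ne (show (0 : ℂ) ≠ -1 by simp)] with r hr
  have hne : 1 + g r ≠ 0 := fun h => hr (by linear_combination h)
  simp only [Function.comp_apply]
  rw [Complex.exp_nat_mul, Complex.exp_log hne]

section Moments

open scoped RealInnerProductSpace

variable {d : Type*} [Fintype d] {F : Measure (EuclideanSpace ℝ d)} [IsProbabilityMeasure F]
  {μ : EuclideanSpace ℝ d} {V : Matrix d d ℝ}

theorem integral_inner_sub_mul_inner_sub (hF : MemLp (fun x => x) 4 F) (hμ : ∫ x, x ∂F = μ)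
    (hV : ∀ s s', cov[fun x => x s, fun x => x s'; F] = V s s') (b c : EuclideanSpace ℝ d) :
    ∫ x, ⟪b, x - μ⟫ * ⟪c, x - μ⟫ ∂F = b.ofLp ⬝ᵥ (V *ᵥ c.ofLp) := by
  have h2 : MemLp id 2 F := hF.mono_exponent (by norm_num)
  have hs (s : d) : MemLp (fun x : EuclideanSpace ℝ d => x s) 2 F :=
    (EuclideanSpace.proj (𝕜 := ℝ) s).comp_memLp' h2
  have h := covarianceBilin_apply_pi hs b c
  have hid : (fun x : EuclideanSpace ℝ d => WithLp.toLp 2 (fun s => x s)) = id := rfl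
  rw [hid, Measure.map_id, covarianceBilin_apply h2] at h
  simp only [id, hμ] at h
  rw [h]
  simp only [hV, dotProduct, mulVec, Finset.mul_sum]
  refine Finset.sum_congr rfl fun i _ => Finset.sum_congr rfl fun j _ => by ring

theorem posSemidef_of_covariance_eq (hF : MemLp (fun x => x) 4 F) (hμ : ∫ x, x ∂F = μ)
    (hV : ∀ s s', cov[fun x => x s, fun x => x s'; F] = V s s') : V.PosSemidef := by
  refine PosSemidef.of_dotProduct_mulVec_nonneg ?_ fun c => ?_
  · ext s s'
    simp [← hV, covariance_comm]
  · have h := integral_inner_sub_mul_inner_sub hF hμ hV (WithLp.toLp 2 c) (WithLp.toLp 2 c)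
    simp only [star_trivial]
    rw [← h]
    exact integral_nonneg fun x => mul_self_nonneg _

/-- Centring kills the linear Taylor term and the quadratic one integrates to the variance. The
cubic remainder is bounded through `y³ ≤ 1 + y⁴`, so a fourth moment bound makes the estimate
uniform. -/
theorem norm_integral_cexp_inner_sub_le (hF : MemLp (fun x => x) 4 F) (hμ : ∫ x, x ∂F = μ)
    (hV : ∀ s s', cov[fun x => x s, fun x => x s'; F] = V s s') (c : EuclideanSpace ℝ d) :
    ‖∫ x, Complex.exp ((⟪c, x - μ⟫ : ℝ) * Complex.I) ∂F -
        (1 - ((c.ofLp ⬝ᵥ (V *ᵥ c.ofLp) : ℝ) : ℂ) / 2)‖ ≤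
      4 * ‖c‖ ^ 3 * (1 + ∫ x, ‖x - μ‖ ^ 4 ∂F) := by
  have hF' : MemLp (fun x => x - μ) 4 F := hF.sub (memLp_const μ)
  have hi4 : Integrable (fun x => ‖x - μ‖ ^ 4) F := hF'.integrable_norm_pow (by norm_num)
  have hi1 : Integrable (fun x => ⟪c, x - μ⟫) F :=
    ((innerSL ℝ c).comp_memLp' hF').integrable (by norm_num)
  have hi2 : Integrable (fun x => ⟪c, x - μ⟫ ^ 2) F :=
    (((innerSL ℝ c).comp_memLp' hF').mono_exponent (by norm_num : (2 : ENNReal) ≤ 4)).integrable_sq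
  have hie : Integrable (fun x => Complex.exp ((⟪c, x - μ⟫ : ℝ) * Complex.I)) F := by
    refine Integrable.of_bound (by fun_prop) 1 (.of_forall fun x => ?_)
    rw [Complex.norm_exp_ofReal_mul_I]
  have h1 : ∫ x, ⟪c, x - μ⟫ ∂F = 0 := by
    rw [integral_inner (hF'.integrable (by norm_num)), integral_sub (hF.integrable (by norm_num))
      (integrable_const _), hμ]
    simp
  have h2 : ∫ x, ⟪c, x - μ⟫ ^ 2 ∂F = c.ofLp ⬝ᵥ (V *ᵥ c.ofLp) := by
    simpa [sq] using integral_inner_sub_mul_inner_sub hF hμ hV c c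
  have hi2' : Integrable (fun x => ((⟪c, x - μ⟫ : ℝ) : ℂ) ^ 2 / 2) F := by
    simpa using (hi2.ofReal (𝕜 := ℂ)).div_const 2
  have hiI : Integrable (fun x => ((⟪c, x - μ⟫ : ℝ) : ℂ) * Complex.I) F :=
    (hi1.ofReal (𝕜 := ℂ)).mul_const _
  have hi1' : Integrable (fun x => 1 + ((⟪c, x - μ⟫ : ℝ) : ℂ) * Complex.I) F :=
    (integrable_const _).add hiI
  have hT : Integrable (fun x => 1 + ((⟪c, x - μ⟫ : ℝ) : ℂ) * Complex.I -
      ((⟪c, x - μ⟫ : ℝ) : ℂ) ^ 2 / 2) F :=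
    hi1'.sub hi2'
  have hTi : ∫ x, (1 + ((⟪c, x - μ⟫ : ℝ) : ℂ) * Complex.I -
      ((⟪c, x - μ⟫ : ℝ) : ℂ) ^ 2 / 2) ∂F = 1 - ((c.ofLp ⬝ᵥ (V *ᵥ c.ofLp) : ℝ) : ℂ) / 2 := by
    rw [integral_sub hi1' hi2',
      integral_add (integrable_const _) hiI, integral_mul_const,
      integral_div, integral_complex_ofReal, h1, ← h2, ← integral_complex_ofReal]
    simp
  rw [← hTi, ← integral_sub hie hT]
  refine (norm_integral_le_integral_norm _).trans ?_
  have hb : Integrable (fun x => 4 * ‖c‖ ^ 3 * (1 + ‖x - μ‖ ^ 4)) F :=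
    ((integrable_const _).add hi4).const_mul _
  have hR : ∫ x, 4 * ‖c‖ ^ 3 * (1 + ‖x - μ‖ ^ 4) ∂F =
      4 * ‖c‖ ^ 3 * (1 + ∫ x, ‖x - μ‖ ^ 4 ∂F) := by
    rw [integral_const_mul, integral_add (integrable_const _) hi4]
    simp
  rw [← hR]
  refine integral_mono (hie.sub hT).norm hb fun x => ?_
  refine (norm_cexp_mul_I_sub_taylor_le _).trans ?_
  rw [mul_assoc]
  refine mul_le_mul_of_nonneg_left ?_ (by norm_num)
  calc |⟪c, x - μ⟫| ^ 3 ≤ (‖c‖ * ‖x - μ‖) ^ 3 := by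
        gcongr
        exact abs_real_inner_le_norm _ _
    _ = ‖c‖ ^ 3 * ‖x - μ‖ ^ 3 := mul_pow _ _ _
    _ ≤ ‖c‖ ^ 3 * (1 + ‖x - μ‖ ^ 4) := by
        gcongr
        rcases le_total ‖x - μ‖ 1 with h | h
        · have := pow_le_one₀ (n := 3) (norm_nonneg (x - μ)) h
          have : 0 ≤ ‖x - μ‖ ^ 4 := by positivity
          linarith
        · have := pow_le_pow_right₀ h (show 3 ≤ 4 by norm_num)
          linarith

/-- Lyapunov-type limit of the characteristic functions of normalized row sums. -/
theorem tendsto_integral_cexp_inner_pow {F : ℕ → Measure (EuclideanSpace ℝ d)}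
    [∀ r, IsProbabilityMeasure (F r)] {μ : ℕ → EuclideanSpace ℝ d}
    (hF : ∀ r, MemLp (fun x => x) 4 (F r)) (hμ : ∀ r, ∫ x, x ∂(F r) = μ r)
    (hV : ∀ r s s', cov[fun x => x s, fun x => x s'; F r] = V s s')
    {C : ℝ} (hC : ∀ r, ∫ x, ‖x - μ r‖ ^ 4 ∂(F r) ≤ C) {m : ℕ → ℕ} (hm : Tendsto m atTop atTop)
    {c : ℕ → EuclideanSpace ℝ d} {v : ℝ}
    (hc3 : Tendsto (fun r => (m r : ℝ) * ‖c r‖ ^ 3) atTop (𝓝 0))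
    (hc2 : Tendsto (fun r => (m r : ℝ) * ((c r).ofLp ⬝ᵥ (V *ᵥ (c r).ofLp))) atTop (𝓝 v)) :
    Tendsto (fun r => (∫ x, Complex.exp ((⟪c r, x - μ r⟫ : ℝ) * Complex.I) ∂(F r)) ^ m r) atTop
      (𝓝 (Complex.exp (-((v : ℂ) / 2)))) := by
  set φ : ℕ → ℂ := fun r => ∫ x, Complex.exp ((⟪c r, x - μ r⟫ : ℝ) * Complex.I) ∂(F r)
  have hrem : Tendsto (fun r => (m r : ℂ) *
      (φ r - (1 - (((c r).ofLp ⬝ᵥ (V *ᵥ (c r).ofLp) : ℝ) : ℂ) / 2))) atTop (𝓝 0) := by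
    refine squeeze_zero_norm (a := fun r => 4 * (1 + C) * ((m r : ℝ) * ‖c r‖ ^ 3)) (fun r => ?_)
      (by simpa using hc3.const_mul (4 * (1 + C)))
    rw [norm_mul, Complex.norm_natCast]
    calc (m r : ℝ) * _ ≤ m r * (4 * ‖c r‖ ^ 3 * (1 + ∫ x, ‖x - μ r‖ ^ 4 ∂(F r))) := by
          gcongr
          exact norm_integral_cexp_inner_sub_le (hF r) (hμ r) (hV r) (c r)
      _ ≤ m r * (4 * ‖c r‖ ^ 3 * (1 + C)) := by
          gcongr
          exact hC r
      _ = _ := by ring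
  have hvar := (hc2.ofReal.div_const 2).neg
  have hsum := hrem.add hvar
  rw [zero_add] at hsum
  -- Here `g = φ - 1`, and `m g → -v/2`.
  have := tendsto_one_add_pow_exp_of_tendsto_mul (g := fun r => φ r - 1) hm (hsum.congr fun r => by
    push_cast
    ring)
  simpa using this

end Moments

/-! ### Central limit theorem for the stacked means -/

theorem dotProduct_asympCov_mulVec {a : ℕ} {t : Fin a → ℕ} (κ : Fin a → ℝ)
    (V : ∀ i, Matrix (Fin (t i)) (Fin (t i)) ℝ) (u : (Σ i, Fin (t i)) → ℝ) :
    u ⬝ᵥ (asympCov κ V *ᵥ u) =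
      ∑ i, (κ i)⁻¹ * ((fun s => u ⟨i, s⟩) ⬝ᵥ (V i *ᵥ fun s => u ⟨i, s⟩)) := by
  have h (i : Fin a) (s : Fin (t i)) : (asympCov κ V *ᵥ u) ⟨i, s⟩ =
      (κ i)⁻¹ * (V i *ᵥ fun s => u ⟨i, s⟩) s := by
    rw [mulVec, dotProduct, Fintype.sum_sigma, Finset.sum_eq_single i]
    · simp [asympCov, blockDiagonal'_apply_eq, mulVec, dotProduct, Finset.mul_sum, mul_assoc]
    · intro j _ hj
      simp [asympCov, blockDiagonal'_apply_ne _ _ _ hj.symm]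
    · simp
  rw [dotProduct, Fintype.sum_sigma]
  refine Finset.sum_congr rfl fun i _ => ?_
  rw [dotProduct, Finset.mul_sum]
  refine Finset.sum_congr rfl fun s _ => ?_
  rw [h]
  ring

section Design

open scoped RealInnerProductSpace

variable {a : ℕ} {t : Fin a → ℕ} {n : ℕ → Fin a → ℕ}
  {Ω : ℕ → Type*} [∀ r, MeasurableSpace (Ω r)]
  {P : ∀ r, Measure (Ω r)}
  {Y : ∀ r i, Fin (n r i) → Ω r → EuclideanSpace ℝ (Fin (t i))}
  {F : ℕ → ∀ i, Measure (EuclideanSpace ℝ (Fin (t i)))}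
  {μ : ℕ → ∀ i, EuclideanSpace ℝ (Fin (t i))}
  {V : ∀ i, Matrix (Fin (t i)) (Fin (t i)) ℝ} {κ : Fin a → ℝ}

/-- The standardized stacked mean `√N (ȳ - μ)` of the data `y`. -/
noncomputable def scaledMeanError {n : Fin a → ℕ} (μ : ∀ i, EuclideanSpace ℝ (Fin (t i)))
    (y : ∀ i, Fin (n i) → EuclideanSpace ℝ (Fin (t i))) : EuclideanSpace ℝ (Σ i, Fin (t i)) :=
  WithLp.toLp 2 (√(totalSize n : ℝ) • (sampleMean y - stack μ))

/-- The block of `u` that belongs to group `i`. -/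
def groupBlock (u : EuclideanSpace ℝ (Σ i, Fin (t i))) (i : Fin a) :
    EuclideanSpace ℝ (Fin (t i)) :=
  WithLp.toLp 2 fun s => u ⟨i, s⟩

/-- Spreading the centring `μ i` over the `n i` summands displays a linear functional of the error
as a sum of independent terms, one per subject. -/
theorem inner_scaledMeanError {n : Fin a → ℕ} (hn : ∀ i, 0 < n i)
    (μ : ∀ i, EuclideanSpace ℝ (Fin (t i)))
    (y : ∀ i, Fin (n i) → EuclideanSpace ℝ (Fin (t i))) (u : EuclideanSpace ℝ (Σ i, Fin (t i))) :
    ⟪scaledMeanError μ y, u⟫ = ∑ p : Σ i, Fin (n i),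
      ⟪(√(totalSize n : ℝ) / n p.1) • groupBlock u p.1, y p.1 p.2 - μ p.1⟫ := by
  rw [Fintype.sum_sigma, PiLp.inner_apply, Fintype.sum_sigma]
  refine Finset.sum_congr rfl fun i _ => ?_
  have hn' : (n i : ℝ) ≠ 0 := by exact_mod_cast (hn i).ne'
  have h : ∑ k, (y i k - μ i) = (n i : ℝ) • ((n i : ℝ)⁻¹ • ∑ k, y i k - μ i) := by
    rw [smul_sub, smul_inv_smul₀ hn', Finset.sum_sub_distrib]
    simp [Nat.cast_smul_eq_nsmul]
  refine Eq.trans ?_ (inner_sum (𝕜 := ℝ) Finset.univ (fun k => y i k - μ i)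
    ((√(totalSize n : ℝ) / n i) • groupBlock u i))
  rw [h, real_inner_smul_left, real_inner_smul_right, ← mul_assoc,
    div_mul_cancel₀ _ hn', PiLp.inner_apply, Finset.mul_sum]
  refine Finset.sum_congr rfl fun s _ => ?_
  simp [scaledMeanError, groupBlock, sampleMean, stack]
  ring

namespace IsRepeatedMeasuresDesign

theorem aemeasurable_scaledMeanError (hY : IsRepeatedMeasuresDesign P Y F μ V κ) (r : ℕ) :
    AEMeasurable (fun ω => scaledMeanError (μ r) (fun i k => Y r i k ω)) (P r) := by
  have hm (i k) := (hY.hasLaw r i k).aemeasurable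
  unfold scaledMeanError sampleMean stack
  refine (WithLp.measurable_toLp 2 _).comp_aemeasurable (aemeasurable_pi_lambda _ fun p => ?_)
  simp only [Pi.smul_apply, Pi.sub_apply, PiLp.smul_apply, WithLp.ofLp_sum, Finset.sum_apply,
    smul_eq_mul]
  fun_prop

theorem tendsto_size_div (hY : IsRepeatedMeasuresDesign P Y F μ V κ) (i : Fin a) :
    Tendsto (fun r => (totalSize (n r) : ℝ) / n r i) atTop (𝓝 (κ i)⁻¹) := by
  simpa using (hY.ratio_tendsto i).inv₀ (hY.ratio_pos i).ne'

theorem charFun_scaledMeanError (hY : IsRepeatedMeasuresDesign P Y F μ V κ) (r : ℕ)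
    (u : EuclideanSpace ℝ (Σ i, Fin (t i))) :
    charFun ((P r).map fun ω => scaledMeanError (μ r) (fun i k => Y r i k ω)) u =
      ∏ i, (∫ x, Complex.exp ((⟪(√(totalSize (n r) : ℝ) / n r i) • groupBlock u i,
        x - μ r i⟫ : ℝ) * Complex.I) ∂(F r i)) ^ n r i := by
  set W : (p : Σ i, Fin (n r i)) → Ω r → ℝ := fun p ω =>
    ⟪(√(totalSize (n r) : ℝ) / n r p.1) • groupBlock u p.1, Y r p.1 p.2 ω - μ r p.1⟫ with hW
  have hYm (p : Σ i, Fin (n r i)) := (hY.hasLaw r p.1 p.2).aemeasurable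
  have hWm (p) : AEMeasurable (W p) (P r) := by
    have := hYm p
    fun_prop
  have hind : iIndepFun W (P r) := (hY.indep r).comp
    (fun p x => ⟪(√(totalSize (n r) : ℝ) / n r p.1) • groupBlock u p.1, x - μ r p.1⟫)
    (fun p => by fun_prop)
  -- The characteristic function at `u` is that of the real variable `⟪·, u⟫` at `1`.
  have hsum : charFun ((P r).map fun ω => scaledMeanError (μ r) (fun i k => Y r i k ω)) u =
      charFun ((P r).map fun ω => ∑ p, W p ω) 1 := by
    rw [charFun_apply, integral_map (hY.aemeasurable_scaledMeanError r) (by fun_prop),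
      charFun_apply_real, integral_map (by fun_prop) (by fun_prop)]
    simp_rw [inner_scaledMeanError (hY.size_pos r)]
    simp [hW]
  rw [hsum, hind.charFun_map_fun_sum_eq_prod hWm, Finset.prod_apply, Fintype.prod_sigma]
  refine Finset.prod_congr rfl fun i _ => ?_
  rw [Finset.prod_eq_pow_card (b := ∫ x, Complex.exp ((⟪(√(totalSize (n r) : ℝ) / n r i) •
    groupBlock u i, x - μ r i⟫ : ℝ) * Complex.I) ∂(F r i))]
  · simp
  · intro k _
    rw [charFun_apply_real, integral_map (hWm _) (by fun_prop)]
    simp only [hW, Complex.ofReal_one, one_mul]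
    exact (hY.hasLaw r i k).integral_comp (f := fun x =>
      Complex.exp ((⟪(√(totalSize (n r) : ℝ) / n r i) •
        groupBlock u i, x - μ r i⟫ : ℝ) * Complex.I)) (by fun_prop)

variable [∀ r, IsProbabilityMeasure (P r)]

theorem isProbabilityMeasure_law (hY : IsRepeatedMeasuresDesign P Y F μ V κ) (r : ℕ) (i : Fin a) :
    IsProbabilityMeasure (F r i) :=
  (hY.hasLaw r i ⟨0, hY.size_pos r i⟩).isProbabilityMeasure_iff.1 inferInstance

theorem posSemidef_asympCov (hY : IsRepeatedMeasuresDesign P Y F μ V κ) :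
    (asympCov κ V).PosSemidef := by
  have hV (i : Fin a) : (V i).PosSemidef := by
    -- `V i` does not depend on the stage, so stage `0` suffices.
    have := hY.isProbabilityMeasure_law 0 i
    exact posSemidef_of_covariance_eq (hY.memLp_four 0 i) (hY.mean_eq 0 i) (hY.cov_eq 0 i)
  refine PosSemidef.of_dotProduct_mulVec_nonneg ?_ fun x => ?_
  · rw [Matrix.IsHermitian, asympCov, blockDiagonal'_conjTranspose]
    congr 1
    ext1 i
    rw [conjTranspose_smul, (hV i).1]
    simp
  · rw [star_trivial, dotProduct_asympCov_mulVec]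
    refine Finset.sum_nonneg fun i _ => mul_nonneg (inv_nonneg.2 (hY.ratio_pos i).le) ?_
    simpa using (hV i).dotProduct_mulVec_nonneg fun s => x ⟨i, s⟩

theorem tendsto_charFun_scaledMeanError (hY : IsRepeatedMeasuresDesign P Y F μ V κ)
    (u : EuclideanSpace ℝ (Σ i, Fin (t i))) :
    Tendsto (fun r => charFun ((P r).map fun ω =>
      scaledMeanError (μ r) (fun i k => Y r i k ω)) u) atTop
      (𝓝 (charFun (multivariateGaussian 0 (asympCov κ V)) u)) := by
  obtain ⟨C, hC⟩ := hY.fourth_moment_bdd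
  have hlim : charFun (multivariateGaussian 0 (asympCov κ V)) u =
      ∏ i, Complex.exp (-((((κ i)⁻¹ * ((groupBlock u i).ofLp ⬝ᵥ
        (V i *ᵥ (groupBlock u i).ofLp)) : ℝ) : ℂ) / 2)) := by
    rw [charFun_multivariateGaussian hY.posSemidef_asympCov, dotProduct_asympCov_mulVec,
      ← Complex.exp_sum, Finset.sum_neg_distrib, ← Finset.sum_div]
    simp [groupBlock]
  simp_rw [hY.charFun_scaledMeanError, hlim]
  refine tendsto_finsetProd _ fun i _ => ?_
  have := fun r => hY.isProbabilityMeasure_law r i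
  have hpos (r) : (0 : ℝ) < n r i := by exact_mod_cast hY.size_pos r i
  have hsq (r) : (n r i : ℝ) * (√(totalSize (n r) : ℝ) / n r i) ^ 2 =
      (totalSize (n r) : ℝ) / n r i := by
    rw [div_pow, Real.sq_sqrt (Nat.cast_nonneg _)]
    field_simp [(hpos r).ne']
  have hinv : Tendsto (fun r => ((n r i : ℝ))⁻¹) atTop (𝓝 0) :=
    tendsto_inv_atTop_zero.comp (tendsto_natCast_atTop_atTop.comp (hY.size_tendsto i))
  -- `√N / n_i` is the square root of `(N / n_i) · n_i⁻¹`.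
  have hroot : Tendsto (fun r => √(totalSize (n r) : ℝ) / n r i) atTop (𝓝 0) := by
    have h := ((hY.tendsto_size_div i).mul hinv).sqrt
    rw [mul_zero, Real.sqrt_zero] at h
    refine h.congr fun r => ?_
    have : (totalSize (n r) : ℝ) / n r i * (n r i : ℝ)⁻¹ =
        (√(totalSize (n r) : ℝ) / n r i) ^ 2 := by
      rw [← hsq]
      field_simp [(hpos r).ne']
    rw [this, Real.sqrt_sq (by positivity)]
  refine tendsto_integral_cexp_inner_pow (fun r => hY.memLp_four r i) (fun r => hY.mean_eq r i)
    (fun r => hY.cov_eq r i) (fun r => hC r i) (hY.size_tendsto i) ?_ ?_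
  -- Lyapunov condition: `n_i ‖c‖³ = (N / n_i) (√N / n_i) ‖u_i‖³ → 0`.
  · have h := (((hY.tendsto_size_div i).mul hroot).mul_const (‖groupBlock u i‖ ^ 3))
    rw [mul_zero, zero_mul] at h
    refine h.congr fun r => ?_
    rw [← hsq, norm_smul, Real.norm_of_nonneg (by positivity)]
    ring
  -- The variances carry the factor `N / n_i → κ_i⁻¹`, the weight of block `i` in `Σ`.
  · refine ((hY.tendsto_size_div i).mul_const _).congr fun r => ?_
    rw [← hsq, WithLp.ofLp_smul, mulVec_smul, dotProduct_smul, smul_dotProduct]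
    simp only [smul_eq_mul]
    ring

/-- Central limit theorem for the stacked group means. -/
theorem tendstoInDistribution_scaledMeanError (hY : IsRepeatedMeasuresDesign P Y F μ V κ) :
    TendstoInDistribution (fun r ω => scaledMeanError (μ r) (fun i k => Y r i k ω)) atTop
      id P (multivariateGaussian 0 (asympCov κ V)) where
  forall_aemeasurable := hY.aemeasurable_scaledMeanError
  aemeasurable_limit := aemeasurable_id
  tendsto := by
    refine ProbabilityMeasure.tendsto_of_tendsto_charFun fun u => ?_
    simpa using hY.tendsto_charFun_scaledMeanError u

end IsRepeatedMeasuresDesign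

end Design

/-! ### Limit law of the ANOVA-type statistic -/

/-- As `z' T z = ‖T z‖²`, only `T z` matters, and `√N T μ = T ν` gives `T(ν + √N(Ȳ - μ)) = √N T Ȳ`.
-/
theorem anovaTypeStat_eq_quadForm {a m : ℕ} {t : Fin a → ℕ} {n : Fin a → ℕ}
    {H : Matrix (Fin m) (Σ i, Fin (t i)) ℝ} {G : Matrix (Fin m) (Fin m) ℝ}
    (hG : IsGInverse (H * Hᵀ) G) {μ : ∀ i, EuclideanSpace ℝ (Fin (t i))}
    (ν : EuclideanSpace ℝ (Σ i, Fin (t i)))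
    (hμ : √(totalSize n : ℝ) • (projMatrix H G *ᵥ stack μ) = projMatrix H G *ᵥ ν.ofLp)
    (y : ∀ i, Fin (n i) → EuclideanSpace ℝ (Fin (t i))) :
    anovaTypeStat H G y = (ν + scaledMeanError μ y).ofLp ⬝ᵥ
      (projMatrix H G *ᵥ (ν + scaledMeanError μ y).ofLp) := by
  have h : projMatrix H G *ᵥ (ν + scaledMeanError μ y).ofLp =
      √(totalSize n : ℝ) • (projMatrix H G *ᵥ sampleMean y) := by
    rw [WithLp.ofLp_add, mulVec_add, ← hμ, scaledMeanError]
    simp only [mulVec_smul, mulVec_sub, smul_sub]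
    abel
  rw [hG.dotProduct_projMatrix, h, anovaTypeStat, hG.dotProduct_projMatrix, smul_dotProduct,
    dotProduct_smul, smul_smul, Real.mul_self_sqrt (Nat.cast_nonneg _), smul_eq_mul]

theorem multivariateGaussian_map_const_add {ι : Type*} [Fintype ι] [DecidableEq ι]
    (ν μ : EuclideanSpace ℝ ι) (S : Matrix ι ι ℝ) :
    (multivariateGaussian μ S).map (fun x => ν + x) = multivariateGaussian (ν + μ) S := by
  rw [multivariateGaussian, multivariateGaussian, Measure.map_map (by fun_prop) (by fun_prop)]
  simp only [Function.comp_def, add_assoc]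

theorem MeasureTheory.TendstoInDistribution.congr_identDistrib {Ω : ℕ → Type*} {Ω' Ω'' E : Type*}
    [∀ r, MeasurableSpace (Ω r)] [MeasurableSpace Ω'] [MeasurableSpace Ω''] [TopologicalSpace E]
    [MeasurableSpace E] [OpensMeasurableSpace E] {P : ∀ r, Measure (Ω r)}
    [∀ r, IsProbabilityMeasure (P r)] {μ : Measure Ω'} [IsProbabilityMeasure μ] {μ' : Measure Ω''}
    [IsProbabilityMeasure μ'] {X : ∀ r, Ω r → E} {Z : Ω' → E} {W : Ω'' → E}
    (h : TendstoInDistribution X atTop Z P μ) (hZW : IdentDistrib Z W μ μ') :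
    TendstoInDistribution X atTop W P μ' where
  forall_aemeasurable := h.forall_aemeasurable
  aemeasurable_limit := hZW.aemeasurable_snd
  tendsto := by
    have := h.tendsto
    simp only [hZW.map_eq] at this
    exact this

theorem IsRepeatedMeasuresDesign.tendstoInDistribution_anovaTypeStat {a m : ℕ} {t : Fin a → ℕ}
    {n : ℕ → Fin a → ℕ} {Ω : ℕ → Type*} [∀ r, MeasurableSpace (Ω r)]
    {P : ∀ r, Measure (Ω r)} [∀ r, IsProbabilityMeasure (P r)]
    {Y : ∀ r i, Fin (n r i) → Ω r → EuclideanSpace ℝ (Fin (t i))}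
    {F : ℕ → ∀ i, Measure (EuclideanSpace ℝ (Fin (t i)))}
    {μ : ℕ → ∀ i, EuclideanSpace ℝ (Fin (t i))}
    {V : ∀ i, Matrix (Fin (t i)) (Fin (t i)) ℝ} {κ : Fin a → ℝ}
    (hY : IsRepeatedMeasuresDesign P Y F μ V κ)
    {H : Matrix (Fin m) (Σ i, Fin (t i)) ℝ} {G : Matrix (Fin m) (Fin m) ℝ}
    (hG : IsGInverse (H * Hᵀ) G) (ν : EuclideanSpace ℝ (Σ i, Fin (t i)))
    (hμ : ∀ r, √(totalSize (n r) : ℝ) • (projMatrix H G *ᵥ stack (μ r)) =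
      projMatrix H G *ᵥ ν.ofLp) :
    TendstoInDistribution (fun r ω => anovaTypeStat H G (fun i k => Y r i k ω)) atTop
      (fun z : EuclideanSpace ℝ (Σ i, Fin (t i)) => z.ofLp ⬝ᵥ (projMatrix H G *ᵥ z.ofLp))
      P (multivariateGaussian ν (asympCov κ V)) := by
  set q : EuclideanSpace ℝ (Σ i, Fin (t i)) → ℝ :=
    fun z => z.ofLp ⬝ᵥ (projMatrix H G *ᵥ z.ofLp) with hq
  have hqc : Continuous q := by fun_prop
  have h := hY.tendstoInDistribution_scaledMeanError.continuous_comp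
    (g := fun x => q (ν + x)) (by fun_prop)
  have hstat : (fun r ω => anovaTypeStat H G (fun i k => Y r i k ω)) = fun r =>
      (fun x => q (ν + x)) ∘ fun ω => scaledMeanError (μ r) (fun i k => Y r i k ω) := by
    ext r ω
    exact anovaTypeStat_eq_quadForm hG ν (hμ r) _
  rw [hstat]
  refine h.congr_identDistrib ⟨?_, hqc.measurable.aemeasurable, ?_⟩
  · have : Continuous ((fun x => q (ν + x)) ∘ id) := by fun_prop
    exact this.measurable.aemeasurable
  · have := multivariateGaussian_map_const_add ν 0 (asympCov κ V)
    rw [add_zero] at this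
    rw [← this, Measure.map_map hqc.measurable (by fun_prop)]
    rfl

open scoped MatrixOrder in
/-- For positive definite `S`, an orthonormal eigenbasis of `√S T √S` turns
into an `S`-orthonormal eigenbasis of `T S`. -/
theorem Matrix.PosDef.exists_eigenvectors_mul {ι : Type*} [Fintype ι] [DecidableEq ι]
    {S T : Matrix ι ι ℝ} (hS : S.PosDef) {lam : ι → ℝ}
    (b : OrthonormalBasis ι ℝ (EuclideanSpace ℝ ι))
    (hb : ∀ j, (CFC.sqrt S * T * CFC.sqrt S) *ᵥ (b j).ofLp = lam j • (b j).ofLp)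
    (ν : EuclideanSpace ℝ ι) :
    ∃ (w : ι → ι → ℝ) (c : EuclideanSpace ℝ ι), ν.ofLp = CFC.sqrt S *ᵥ c.ofLp ∧
      (∀ j, w j ⬝ᵥ ν.ofLp = (b j).ofLp ⬝ᵥ c.ofLp) ∧
      (∀ j, (T * S) *ᵥ w j = lam j • w j) ∧
      (∀ j l, w j ⬝ᵥ (S *ᵥ w l) = if j = l then 1 else 0) ∧
      ∑ j, (w j ⬝ᵥ ν.ofLp) ^ 2 = ν.ofLp ⬝ᵥ (S⁻¹ *ᵥ ν.ofLp) := by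
  set R := CFC.sqrt S with hR
  have hRR : R * R = S := hS.posSemidef.sqrt_mul_sqrt
  have hRs : Rᵀ = R := isSymm_sqrt S
  have hdet : IsUnit R.det := by
    have h : IsUnit S.det := (isUnit_iff_isUnit_det S).1 hS.isUnit
    rw [← hRR, det_mul] at h
    exact isUnit_of_mul_isUnit_left h
  have hRi : R * R⁻¹ = 1 := mul_nonsing_inv R hdet
  have hiR : R⁻¹ * R = 1 := nonsing_inv_mul R hdet
  have hRis : (R⁻¹)ᵀ = R⁻¹ := by rw [transpose_nonsing_inv, hRs]
  have hSR : S * R⁻¹ = R := by rw [← hRR, Matrix.mul_assoc, hRi, Matrix.mul_one]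
  have hwν (j) : (R⁻¹ *ᵥ (b j).ofLp) ⬝ᵥ ν.ofLp = (b j).ofLp ⬝ᵥ (R⁻¹ *ᵥ ν.ofLp) := by
    rw [dotProduct_mulVec, ← mulVec_transpose, hRis]
  refine ⟨fun j => R⁻¹ *ᵥ (b j).ofLp, WithLp.toLp 2 (R⁻¹ *ᵥ ν.ofLp), ?_, hwν, fun j => ?_,
    fun j l => ?_, ?_⟩
  · rw [mulVec_mulVec, hRi, one_mulVec]
  · have h : T * S * R⁻¹ = R⁻¹ * (R * T * R) := by
      rw [Matrix.mul_assoc T, hSR, ← Matrix.mul_assoc, ← Matrix.mul_assoc, hiR, Matrix.one_mul]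
    rw [mulVec_mulVec, h, ← mulVec_mulVec, hb, mulVec_smul]
  · rw [mulVec_mulVec, hSR, dotProduct_mulVec, ← mulVec_transpose, hRs, mulVec_mulVec, hRi,
      one_mulVec]
    have := orthonormal_iff_ite.1 b.orthonormal j l
    rw [← this, PiLp.inner_apply, dotProduct]
    simp [mul_comm]
  -- Parseval for `R⁻¹ ν` in the basis `b`, with `S⁻¹ = R⁻¹ R⁻¹`.
  · have h := b.sum_sq_inner_right (WithLp.toLp 2 (R⁻¹ *ᵥ ν.ofLp))
    have hSi : S⁻¹ = R⁻¹ * R⁻¹ := by rw [← hRR, mul_inv_rev]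
    simp_rw [hwν]
    rw [hSi, ← mulVec_mulVec, dotProduct_mulVec, ← mulVec_transpose, hRis]
    rw [EuclideanSpace.real_norm_sq_eq] at h
    simpa [PiLp.inner_apply, dotProduct, mul_comm, sq] using h

theorem theorem2p1 {a m : ℕ} {t : Fin a → ℕ} {n : ℕ → Fin a → ℕ}
    {Ω : ℕ → Type*} [∀ r, MeasurableSpace (Ω r)]
    (P : ∀ r, Measure (Ω r)) [∀ r, IsProbabilityMeasure (P r)]
    (Y : ∀ r i, Fin (n r i) → Ω r → EuclideanSpace ℝ (Fin (t i)))
    (F : ℕ → ∀ i, Measure (EuclideanSpace ℝ (Fin (t i))))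
    (μ : ℕ → ∀ i, EuclideanSpace ℝ (Fin (t i)))
    (V : ∀ i, Matrix (Fin (t i)) (Fin (t i)) ℝ) (κ : Fin a → ℝ)
    (hY : IsRepeatedMeasuresDesign P Y F μ V κ)
    (H : Matrix (Fin m) (Σ i, Fin (t i)) ℝ) (G : Matrix (Fin m) (Fin m) ℝ)
    (hG : IsGInverse (H * Hᵀ) G) :
    -- the eigenvalues of `T Σ` are real ...
    (∃ lam, ListsEigenvalues (projMatrix H G * asympCov κ V) lam) ∧
    -- ... and for any listing `lam` of them:
    ∀ lam, ListsEigenvalues (projMatrix H G * asympCov κ V) lam →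
      -- limit law under the null hypothesis `H μ = 0`
      ((∀ r, H *ᵥ stack (μ r) = 0) →
        TendstoInDistribution (fun r ω => anovaTypeStat H G (fun i k => Y r i k ω)) atTop
          (fun x : (Σ i, Fin (t i)) → ℝ => ∑ j, lam j * x j)
          P (Measure.pi fun _ => chiSqOne)) ∧
      -- limit law under the local alternatives `T μ = T ν / √N`
      ∀ ν : EuclideanSpace ℝ (Σ i, Fin (t i)),
        (∀ r, projMatrix H G *ᵥ stack (μ r) =
          (1 / √(totalSize (n r) : ℝ)) • (projMatrix H G *ᵥ ν.ofLp)) →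
        TendstoInDistribution (fun r ω => anovaTypeStat H G (fun i k => Y r i k ω)) atTop
          (fun z : EuclideanSpace ℝ (Σ i, Fin (t i)) => z.ofLp ⬝ᵥ (projMatrix H G *ᵥ z.ofLp))
          P (multivariateGaussian ν (asympCov κ V)) ∧
        -- representation of the limit by noncentral chi-square variables if `Σ > 0`
        ((asympCov κ V).PosDef →
          ∃ w : (Σ i, Fin (t i)) → (Σ i, Fin (t i)) → ℝ,
            (∀ j, (projMatrix H G * asympCov κ V) *ᵥ w j = lam j • w j) ∧
            (∀ j l, w j ⬝ᵥ (asympCov κ V *ᵥ w l) = if j = l then 1 else 0) ∧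
            ∑ j, (w j ⬝ᵥ ν.ofLp) ^ 2 = ν.ofLp ⬝ᵥ ((asympCov κ V)⁻¹ *ᵥ ν.ofLp) ∧
            IdentDistrib
              (fun z : EuclideanSpace ℝ (Σ i, Fin (t i)) =>
                z.ofLp ⬝ᵥ (projMatrix H G *ᵥ z.ofLp))
              (fun x : (Σ i, Fin (t i)) → ℝ => ∑ j, lam j * x j)
              (multivariateGaussian ν (asympCov κ V))
              (Measure.pi fun j => noncentralChiSqOne ((w j ⬝ᵥ ν.ofLp) ^ 2)) ∧
            TendstoInDistribution (fun r ω => anovaTypeStat H G (fun i k => Y r i k ω)) atTop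
              (fun x : (Σ i, Fin (t i)) → ℝ => ∑ j, lam j * x j)
              P (Measure.pi fun j => noncentralChiSqOne ((w j ⬝ᵥ ν.ofLp) ^ 2))) := by
  have hS := hY.posSemidef_asympCov
  have hherm := hG.isSymm_projMatrix.isHermitian_sqrt_conj (asympCov κ V)
  refine ⟨⟨hherm.eigenvalues, hS.listsEigenvalues_sqrt_conj.1 hherm.listsEigenvalues⟩,
    fun lam hlam => ?_⟩
  obtain ⟨b, hb⟩ := hherm.exists_orthonormalBasis (hS.listsEigenvalues_sqrt_conj.2 hlam)
  refine ⟨fun hμ => ?_, fun ν hν => ?_⟩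
  · have hμ' (r : ℕ) : √(totalSize (n r) : ℝ) • (projMatrix H G *ᵥ stack (μ r)) =
        projMatrix H G *ᵥ (0 : EuclideanSpace ℝ (Σ i, Fin (t i))).ofLp := by
      rw [projMatrix, ← mulVec_mulVec, hμ r]
      simp
    -- Zero lies in the range of `√Σ` even when `Σ` is singular.
    have hid := identDistrib_quadForm_multivariateGaussian b hb 0 0 (by simp)
    simp only [WithLp.ofLp_zero, dotProduct_zero, ne_eq, OfNat.ofNat_ne_zero, not_false_eq_true,
      zero_pow, noncentralChiSqOne_zero] at hid
    exact (hY.tendstoInDistribution_anovaTypeStat hG 0 hμ').congr_identDistrib hid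
  · have hν' (r : ℕ) : √(totalSize (n r) : ℝ) • (projMatrix H G *ᵥ stack (μ r)) =
        projMatrix H G *ᵥ ν.ofLp := by
      -- A coordinate `p` supplies a nonempty group, hence `N > 0`; without coordinates nothing is
      -- to be shown.
      ext p
      have hN : (0 : ℝ) < totalSize (n r) := by
        have : n r p.1 ≤ totalSize (n r) :=
          Finset.single_le_sum (fun i _ => Nat.zero_le (n r i)) (Finset.mem_univ p.1)
        exact_mod_cast (hY.size_pos r p.1).trans_le this
      rw [hν r, smul_smul, mul_one_div_cancel (Real.sqrt_pos.2 hN).ne', one_smul]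
    have hT := hY.tendstoInDistribution_anovaTypeStat hG ν hν'
    refine ⟨hT, fun hpd => ?_⟩
    obtain ⟨w, c, hc, hwc, heig, horth, hsum⟩ := hpd.exists_eigenvectors_mul b hb ν
    have hid := identDistrib_quadForm_multivariateGaussian b hb c ν hc
    simp only [← hwc] at hid
    exact ⟨w, heig, horth, hsum, hid, hT.congr_identDistrib hid⟩
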